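/- Let $A$ be a $C^*$-algebra (not necessarily unital), regarded as a right Hilbert module over itself with $\langle a,b\rangle=a^*b$, and let $M(A)$ be its multiplier algebra, i.e. the algebra of adjointable operators on $A$. A regular operator on $A$ is a closed, densely defined, $A$-linear operator $T:D(T)\to A$ (with $D(T)$ a right submodule of $A$) such that $T^*$ is densely defined and $I+T^*T$ has dense range; its $z$-transform is $z=T(I+T^*T)^{-1/2}\in M(A)$. Let $T$ be a regular operator on $A$ with $z$-transform $z$, and let $S$ be a regular operator on $A$ with $z$-transform $z_S$. Then $S$ is an extension of $T$ if and only if there is a coisometry $u\in M(A)$ (that is, $uu^*=I$) such that $z_S=uz$ and $$\bigl(u(I-zz^*)u^*\bigr)^{1/2}=u(I-zz^*)^{1/2}.$$ -/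

import Mathlib

open scoped MultiplierAlgebra

/-! A C⋆-algebra `A` is viewed as a Hilbert module over itself: the right action is right
multiplication and `⟪a, b⟫ = star a * b`. Its adjointable operators are the elements `m` of the
multiplier algebra `𝓜(ℂ, A)`, with `m` acting on `A` by left multiplication `a ↦ m.fst a`.
An operator on `A` is a partially defined linear map `A →ₗ.[ℂ] A`. -/

namespace RegOp

section

variable {A : Type*} [NonUnitalCStarAlgebra A]

/-- The usual order of the C⋆-algebra `𝓜(ℂ, A)`: `a ≤ b` iff `b - a` is self-adjoint with
nonnegative spectrum. It is needed to speak about positive elements and their square roots. -/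
noncomputable instance instPartialOrderMultiplier : PartialOrder 𝓜(ℂ, A) :=
  CStarAlgebra.spectralOrder _

instance instStarOrderedRingMultiplier : StarOrderedRing 𝓜(ℂ, A) :=
  CStarAlgebra.spectralOrderedRing _

/-- The set of pairs `(y, w)` with `⟪T x, y⟫ = ⟪x, w⟫` for all `x` in the domain of `T`. For
densely defined `T` it is the graph of the adjoint of `T`, see `graph_adjoint`. -/
def adjointGraph (T : A →ₗ.[ℂ] A) : Submodule ℂ (A × A) where
  carrier := {q | ∀ x : T.domain, star (T x) * q.1 = star (x : A) * q.2}
  add_mem' := by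
    intro p q hp hq x
    simp only [Prod.fst_add, Prod.snd_add, mul_add, hp x, hq x]
  zero_mem' := by
    intro x
    simp
  smul_mem' := by
    intro c q hq x
    simp only [Prod.smul_fst, Prod.smul_snd, mul_smul_comm, hq x]

/-- The adjoint `T⋆` of a densely defined operator `T` on `A`: an element `y` is in its domain iff
there is `w` with `⟪T x, y⟫ = ⟪x, w⟫` for all `x` in the domain of `T`, and then `T⋆ y = w`. -/
noncomputable def adjoint (T : A →ₗ.[ℂ] A) : A →ₗ.[ℂ] A :=
  (adjointGraph T).toLinearPMap

/-- The adjoint of a densely defined operator is well defined. -/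
theorem graph_adjoint (T : A →ₗ.[ℂ] A) (hT : Dense (T.domain : Set A)) :
    (adjoint T).graph = adjointGraph T := by
  refine Submodule.toLinearPMap_graph_eq _ ?_
  rintro ⟨y, w⟩ h hy
  obtain rfl : y = 0 := hy
  have h0 : ∀ a : A, star a * w = 0 := by
    have hc : Continuous fun a : A => star a * w := by fun_prop
    have := hc.ext_on hT (continuous_const (y := (0 : A))) (fun a ha => by
      have := h ⟨a, ha⟩
      simpa using this.symm)
    exact fun a => congrFun this a
  exact CStarRing.star_mul_self_eq_zero_iff w |>.mp (h0 w)

/-- The graph of `I + T⋆T`, whose domain consists of the `x` in the domain of `T` with `T x` in the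
domain of `T⋆`. -/
def graphOneAddAdjointMul (T : A →ₗ.[ℂ] A) : Set (A × A) :=
  {q | ∃ (x : T.domain) (h : T x ∈ (adjoint T).domain),
    q = ((x : A), (x : A) + adjoint T ⟨T x, h⟩)}

/-- Regular operators on the Hilbert module `A`: closed densely defined `A`-linear operators with
densely defined adjoint such that `I + T⋆T` has dense range. -/
structure IsRegular (T : A →ₗ.[ℂ] A) : Prop where
  dense_domain : Dense (T.domain : Set A)
  mul_mem_domain : ∀ x ∈ T.domain, ∀ a : A, x * a ∈ T.domain
  map_mul : ∀ (x : T.domain) (a : A), T ⟨x * a, mul_mem_domain x x.2 a⟩ = T x * a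
  isClosed : T.IsClosed
  dense_adjoint_domain : Dense ((adjoint T).domain : Set A)
  dense_range : Dense (Prod.snd '' graphOneAddAdjointMul T)

/-- `z` is the `z`-transform (bounded transform) `T (I + T⋆T)^{-1/2}` of `T`. Here `p` is the
adjointable operator `(I + T⋆T)⁻¹`, that is, a pair `(a, b)` lies in the graph of `I + T⋆T` iff
`a = p b`, and `T` is composed with the positive square root of `p`. -/
def IsZTransform (T : A →ₗ.[ℂ] A) (z : 𝓜(ℂ, A)) : Prop :=
  ∃ p : 𝓜(ℂ, A), 0 ≤ p ∧
    (∀ a b : A, (a, b) ∈ graphOneAddAdjointMul T ↔ a = p.fst b) ∧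
    ∀ a : A, ∃ h : (CFC.sqrt p).fst a ∈ T.domain, T ⟨(CFC.sqrt p).fst a, h⟩ = z.fst a

end

end RegOp

/-! Write `w` for `zS`, `r = (1 - z⋆z)^{1/2}`, `s = (1 - zz⋆)^{1/2}`, `t = (1 - ww⋆)^{1/2}`. The
graph of `T` is the range of the isometry `a ↦ (r a, z a)`, and the graph of `S` is the kernel of
`(x, y) ↦ w x - t y`. Hence `T ≤ S` iff `w r = t z` (`IsZTransform.le_iff`), an identity in the
multiplier algebra. By `mul_sqrt_eq_sqrt_mul_iff` it amounts to a coisometry `u` with `u s = t` and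
`u z = w`, namely `u = t s + w z⋆`. -/

namespace RegOp

section Intertwine

variable {B : Type*} [CStarAlgebra B] [PartialOrder B] [StarOrderedRing B]

/-- An element intertwining the squares of two nonnegative elements intertwines the elements. -/
theorem mul_eq_mul_of_mul_sq_eq {z r s : B} (hr : 0 ≤ r) (hs : 0 ≤ s)
    (h : z * (r * r) = s * s * z) : z * r = s * z := by
  have hr' : star r = r := (IsSelfAdjoint.of_nonneg hr)
  have hs' : star s = s := (IsSelfAdjoint.of_nonneg hs)
  -- The hypothesis says `s X + X r = 0`. So `s (X X⋆) = -X r X⋆` is `≤ 0`; being self-adjoint, it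
  -- is also a product of commuting nonnegative elements, hence `≥ 0`.
  set X := z * r - s * z with hX
  have h1 : s * X = -(X * r) := by
    have : s * X + X * r = z * (r * r) - s * s * z := by rw [hX]; noncomm_ring
    rw [h, sub_self] at this
    exact eq_neg_of_add_eq_zero_left this
  have h1' : star X * s = -(r * star X) := by
    simpa [hr', hs'] using congrArg star h1
  have h2 : s * (X * star X) = -(X * r * star X) := by
    rw [← mul_assoc, h1, neg_mul]
  have hcomm : Commute s (X * star X) := by
    rw [Commute, SemiconjBy, h2, mul_assoc, mul_assoc, h1', mul_neg]
  have hzero : s * (X * star X) = 0 := by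
    refine le_antisymm ?_ (hcomm.mul_nonneg hs (mul_star_self_nonneg X))
    rw [h2]
    exact neg_nonpos.mpr (star_right_conjugate_nonneg hr X)
  have hsX : s * X = 0 := by
    rw [← CStarRing.mul_star_self_eq_zero_iff, star_mul, ← mul_assoc, mul_assoc s, hzero, zero_mul]
  have hXr : X * r = 0 := by rw [hsX] at h1; exact neg_eq_zero.mp h1.symm
  have h3 : star X * X = r * star z * X := by
    have : star X = r * star z - star z * s := by simp [hX, hr', hs']
    rw [this, sub_mul, mul_assoc (star z), hsX, mul_zero, sub_zero]
  have h4 : X * (star X * X) = 0 := by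
    rw [h3, ← mul_assoc, ← mul_assoc, hXr, zero_mul, zero_mul]
  have h5 : star X * X = 0 := by
    rw [← CStarRing.star_mul_self_eq_zero_iff, star_mul, star_star, mul_assoc, h4, mul_zero]
  exact sub_eq_zero.mp ((CStarRing.star_mul_self_eq_zero_iff X).mp h5)

theorem mul_star_self_le_one_of_star_mul_self_le_one {z : B} (h : star z * z ≤ 1) :
    z * star z ≤ 1 := by
  have h' := CStarAlgebra.norm_le_one_iff_of_nonneg (star z * z) (star_mul_self_nonneg z)
  rw [← CStarAlgebra.norm_le_one_iff_of_nonneg _ (mul_star_self_nonneg z),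
    CStarRing.norm_self_mul_star, ← CStarRing.norm_star_mul_self]
  exact h'.mpr h

end Intertwine

section

variable {A : Type*} [NonUnitalCStarAlgebra A]

theorem fst_mul_apply (m n : 𝓜(ℂ, A)) (a : A) : (m * n).fst a = m.fst (n.fst a) := rfl

theorem star_fst_mul (m : 𝓜(ℂ, A)) (a b : A) :
    star (m.fst a) * b = star a * (star m).fst b := by
  have := (star m).central (star a) b
  simpa using this

theorem eq_of_forall_star_mul_eq {x y : A} (h : ∀ a : A, star a * x = star a * y) : x = y := by
  have h1 := h (x - y)
  rw [← sub_eq_zero, ← mul_sub] at h1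
  exact sub_eq_zero.mp ((CStarRing.star_mul_self_eq_zero_iff _).mp h1)

theorem ext_of_fst {m n : 𝓜(ℂ, A)} (h : ∀ a, m.fst a = n.fst a) : m = n := by
  have h1 : m.fst = n.fst := ContinuousLinearMap.ext h
  have h2 : m.snd = n.snd := by
    refine ContinuousLinearMap.ext fun x => ?_
    have key : ∀ y, m.snd x * y = n.snd x * y := fun y => by
      rw [m.central, n.central, h]
    have := key (star (m.snd x - n.snd x))
    rw [← sub_eq_zero, ← sub_mul] at this
    exact sub_eq_zero.mp ((CStarRing.mul_star_self_eq_zero_iff _).mp this)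
  exact DoubleCentralizer.ext _ _ _ _ (Prod.ext h1 h2)

theorem star_apply_mul_apply_of_mem {T : A →ₗ.[ℂ] A} (hT : Dense (T.domain : Set A)) {a b : A}
    (h : (a, b) ∈ graphOneAddAdjointMul T) :
    ∃ w, (a, w) ∈ T.graph ∧ ∀ x y, (x, y) ∈ T.graph → star y * w = star x * (b - a) := by
  obtain ⟨x, hx, hq⟩ := h
  obtain ⟨rfl, rfl⟩ := Prod.mk.inj hq
  refine ⟨T x, T.mem_graph x, fun v y hv => ?_⟩
  obtain ⟨v, rfl, rfl⟩ := (T.mem_graph_iff).mp hv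
  have hmem := (adjoint T).mem_graph ⟨T x, hx⟩
  rw [graph_adjoint T hT] at hmem
  simpa using hmem v

theorem eq_zero_of_zero_mem_graphOneAddAdjointMul {T : A →ₗ.[ℂ] A} {b : A}
    (h : ((0 : A), b) ∈ graphOneAddAdjointMul T) : b = 0 := by
  obtain ⟨x, hx, hq⟩ := h
  obtain ⟨h0, rfl⟩ := Prod.mk.inj hq
  obtain rfl : x = 0 := Subtype.ext h0.symm
  have : (⟨T 0, hx⟩ : (adjoint T).domain) = 0 := Subtype.ext (by simp)
  rw [this]
  simp

/-- The `z`-transform is a contraction `z`, and the graph of the operator is the range of the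
isometry `a ↦ ((1 - z⋆z)^{1/2} a, z a)`. -/
theorem IsZTransform.le_one_and_mem_graph_iff {T : A →ₗ.[ℂ] A} (hT : Dense (T.domain : Set A))
    {z : 𝓜(ℂ, A)} (hz : IsZTransform T z) :
    star z * z ≤ 1 ∧ ∀ x y, (x, y) ∈ T.graph ↔
      ∃ a, x = (CFC.sqrt (1 - star z * z)).fst a ∧ y = z.fst a := by
  obtain ⟨p, hp, hgraph, hsqrt⟩ := hz
  set r := CFC.sqrt p with hr
  have hrr : r * r = p := CFC.sqrt_mul_sqrt_self p hp
  have hrs : star r = r := IsSelfAdjoint.of_nonneg (CFC.sqrt_nonneg p)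
  have hmem : ∀ a, (r.fst a, z.fst a) ∈ T.graph := fun a => by
    obtain ⟨h, h'⟩ := hsqrt a
    exact (T.mem_graph_iff).mpr ⟨⟨_, h⟩, rfl, h'⟩
  have hpr : ∀ b, p.fst b = r.fst (r.fst b) := fun b => by rw [← fst_mul_apply, hrr]
  have hadj : ∀ b x y, (x, y) ∈ T.graph →
      star y * z.fst (r.fst b) = star x * (b - p.fst b) := fun b => by
    obtain ⟨w, hw, h⟩ := star_apply_mul_apply_of_mem hT ((hgraph (p.fst b) b).mpr rfl)
    have h1 := hmem (r.fst b)
    rw [← hpr] at h1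
    rwa [T.mem_graph_snd_inj hw h1 rfl] at h
  -- The adjoint relation is tested on the graph vectors `(r a, z a)`.
  have hzr : star z * z * r = r * (1 - p) := by
    refine ext_of_fst fun b => eq_of_forall_star_mul_eq fun a => ?_
    have h := hadj b _ _ (hmem a)
    rw [star_fst_mul, star_fst_mul, hrs] at h
    exact h
  have hpz : p * (star z * z - (1 - p)) = 0 := by
    have h1 : r * (star z * z) = (1 - p) * r := by
      have := congrArg star hzr
      simpa [hrs, (IsSelfAdjoint.of_nonneg hp).star_eq] using this
    have h2 : p * (star z * z) = r * (1 - p) * r := by rw [← hrr, mul_assoc r r, h1, hrr, mul_assoc]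
    rw [mul_sub, h2, ← hrr]
    noncomm_ring
  -- The factor `p` cancels: it is injective, since `p b = 0` puts `(0, b)` in the graph of `I +
  -- T⋆T`.
  have hzz : star z * z = 1 - p := by
    refine sub_eq_zero.mp (ext_of_fst fun b => ?_)
    refine eq_zero_of_zero_mem_graphOneAddAdjointMul (T := T) ((hgraph _ _).mpr ?_)
    rw [← fst_mul_apply, hpz]
    rfl
  have hp1 : 1 - star z * z = p := by rw [hzz, sub_sub_cancel]
  refine ⟨by rw [← sub_nonneg, hp1]; exact hp, fun x y => ?_⟩
  rw [hp1, ← hr]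
  refine ⟨fun hxy => ?_, ?_⟩
  · set c := r.fst x + (star z).fst y with hc
    have hdiff : (x - r.fst c, y - z.fst c) ∈ T.graph := T.graph.sub_mem hxy (hmem c)
    have horth : (star z).fst (y - z.fst c) = -r.fst (x - r.fst c) := by
      have h1 : (star z).fst (z.fst c) = c - r.fst (r.fst c) := by
        rw [← fst_mul_apply, hzz, ← hpr]
        rfl
      rw [map_sub, map_sub, h1, hc]
      abel
    -- With `d = x - r c`, the adjoint relation and orthogonality give `-d⋆ p d = d⋆ (d - p d)`, so
    -- `d⋆ d = 0`.
    have hx : x - r.fst c = 0 := by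
      refine star_eq_zero.mp ((CStarRing.mul_star_self_eq_zero_iff _).mp ?_)
      rw [star_star]
      have h2 := hadj (x - r.fst c) _ _ hdiff
      have h3 : star (y - z.fst c) * z.fst (r.fst (x - r.fst c)) =
          -(star (x - r.fst c) * p.fst (x - r.fst c)) := by
        have h4 := star_fst_mul (star z) (y - z.fst c) (r.fst (x - r.fst c))
        rw [star_star] at h4
        rw [← h4, horth, star_neg, neg_mul, star_fst_mul, hrs, hpr]
      rw [h3, mul_sub, eq_sub_iff_add_eq, neg_add_cancel] at h2
      exact h2.symm
    refine ⟨c, sub_eq_zero.mp hx, sub_eq_zero.mp ?_⟩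
    exact T.graph_fst_eq_zero_snd hdiff hx
  · rintro ⟨a, rfl, rfl⟩
    exact hmem a

theorem mul_sqrt_one_sub_star_mul_self {B : Type*} [CStarAlgebra B] [PartialOrder B]
    [StarOrderedRing B] {z : B} (h : star z * z ≤ 1) :
    z * CFC.sqrt (1 - star z * z) = CFC.sqrt (1 - z * star z) * z := by
  refine mul_eq_mul_of_mul_sq_eq (CFC.sqrt_nonneg _) (CFC.sqrt_nonneg _) ?_
  rw [CFC.sqrt_mul_sqrt_self _ (sub_nonneg.mpr h),
    CFC.sqrt_mul_sqrt_self _ (sub_nonneg.mpr (mul_star_self_le_one_of_star_mul_self_le_one h))]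
  noncomm_ring

/-- The graph of the operator with `z`-transform `z` is the kernel of
`(x, y) ↦ z x - (1 - zz⋆)^{1/2} y`. -/
theorem exists_fst_eq_iff {z : 𝓜(ℂ, A)} (h : star z * z ≤ 1) (x y : A) :
    (∃ a, x = (CFC.sqrt (1 - star z * z)).fst a ∧ y = z.fst a) ↔
      z.fst x = (CFC.sqrt (1 - z * star z)).fst y := by
  have h' := mul_star_self_le_one_of_star_mul_self_le_one h
  have hzr := mul_sqrt_one_sub_star_mul_self h
  have hrr := CFC.sqrt_mul_sqrt_self _ (sub_nonneg.mpr h)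
  have hss := CFC.sqrt_mul_sqrt_self _ (sub_nonneg.mpr h')
  have hrs : star (CFC.sqrt (1 - star z * z)) = _ := IsSelfAdjoint.of_nonneg (CFC.sqrt_nonneg _)
  have hs : star (CFC.sqrt (1 - z * star z)) = _ := IsSelfAdjoint.of_nonneg (CFC.sqrt_nonneg _)
  set r := CFC.sqrt (1 - star z * z)
  set s := CFC.sqrt (1 - z * star z)
  have hrz : r * star z = star z * s := by simpa [hrs, hs] using congrArg star hzr
  constructor
  · rintro ⟨a, rfl, rfl⟩
    rw [← fst_mul_apply, ← fst_mul_apply, hzr]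
  · intro hxy
    -- The preimage under an isometry is found by applying its adjoint.
    refine ⟨r.fst x + (star z).fst y, ?_, ?_⟩
    · rw [map_add, ← fst_mul_apply r r, ← fst_mul_apply r (star z), hrz, fst_mul_apply (star z),
        ← hxy, hrr, ← fst_mul_apply]
      change _ = x - (star z * z).fst x + (star z * z).fst x
      abel
    · rw [map_add, ← fst_mul_apply, hzr, fst_mul_apply, hxy, ← fst_mul_apply, hss,
        ← fst_mul_apply]
      change _ = y - (z * star z).fst y + (z * star z).fst y
      abel

theorem IsZTransform.le_iff {T S : A →ₗ.[ℂ] A} (hT : Dense (T.domain : Set A))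
    (hS : Dense (S.domain : Set A)) {z w : 𝓜(ℂ, A)} (hz : IsZTransform T z)
    (hw : IsZTransform S w) :
    T ≤ S ↔ w * CFC.sqrt (1 - star z * z) = CFC.sqrt (1 - w * star w) * z := by
  obtain ⟨-, hTg⟩ := hz.le_one_and_mem_graph_iff hT
  obtain ⟨hw1, hSg⟩ := hw.le_one_and_mem_graph_iff hS
  rw [← LinearPMap.le_graph_iff]
  constructor
  · intro h
    refine ext_of_fst fun a => ?_
    have := (hSg _ _).mp (h ((hTg _ _).mpr ⟨a, rfl, rfl⟩))
    exact (exists_fst_eq_iff hw1 _ _).mp this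
  · rintro h ⟨x, y⟩ hxy
    obtain ⟨a, rfl, rfl⟩ := (hTg _ _).mp hxy
    refine (hSg _ _).mpr ((exists_fst_eq_iff hw1 _ _).mpr ?_)
    rw [← fst_mul_apply, ← fst_mul_apply, h]

end

theorem mul_sqrt_eq_sqrt_mul_iff {B : Type*} [CStarAlgebra B] [PartialOrder B]
    [StarOrderedRing B] {z w : B} (hz : star z * z ≤ 1) (hw : star w * w ≤ 1) :
    w * CFC.sqrt (1 - star z * z) = CFC.sqrt (1 - w * star w) * z ↔
      ∃ u : B, u * star u = 1 ∧
        CFC.sqrt (u * (1 - z * star z) * star u) = u * CFC.sqrt (1 - z * star z) ∧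
        w = u * z := by
  have hzr := mul_sqrt_one_sub_star_mul_self hz
  have hrr := CFC.sqrt_mul_sqrt_self _ (sub_nonneg.mpr hz)
  have hss := CFC.sqrt_mul_sqrt_self _
    (sub_nonneg.mpr (mul_star_self_le_one_of_star_mul_self_le_one hz))
  have htt := CFC.sqrt_mul_sqrt_self _
    (sub_nonneg.mpr (mul_star_self_le_one_of_star_mul_self_le_one hw))
  have hrs : star (CFC.sqrt (1 - star z * z)) = _ := IsSelfAdjoint.of_nonneg (CFC.sqrt_nonneg _)
  have hs : star (CFC.sqrt (1 - z * star z)) = _ := IsSelfAdjoint.of_nonneg (CFC.sqrt_nonneg _)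
  have ht : star (CFC.sqrt (1 - w * star w)) = _ := IsSelfAdjoint.of_nonneg (CFC.sqrt_nonneg _)
  -- Given this, the square root condition on `u` just reads `t = u s`.
  have hdefect (u : B) (hu : u * star u = 1) (hwu : w = u * z) :
      u * (1 - z * star z) * star u = 1 - w * star w := by
    rw [hwu, star_mul, mul_sub, sub_mul, mul_one, hu]
    noncomm_ring
  constructor
  · intro h
    set r := CFC.sqrt (1 - star z * z)
    set s := CFC.sqrt (1 - z * star z)
    set t := CFC.sqrt (1 - w * star w)
    -- The witness is forced: `u s = t` and `u z = w` give `u = u (s s + z z⋆) = t s + w z⋆`.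
    have hus : (t * s + w * star z) * s = t := by
      have hrz : star z * s = r * star z := by simpa [hrs, hs] using (congrArg star hzr).symm
      rw [add_mul, mul_assoc, hss, mul_assoc w, hrz, ← mul_assoc, h]
      noncomm_ring
    have huz : (t * s + w * star z) * z = w := by
      rw [add_mul, mul_assoc t, ← hzr, ← mul_assoc, ← h, mul_assoc w, mul_assoc w, hrr]
      noncomm_ring
    have huu : (t * s + w * star z) * star (t * s + w * star z) = 1 := by
      rw [star_add, star_mul, star_mul, star_star, hs, ht, mul_add, ← mul_assoc, ← mul_assoc,
        hus, huz, htt, sub_add_cancel]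
    exact ⟨_, huu, by rw [hdefect _ huu huz.symm, hus], huz.symm⟩
  · rintro ⟨u, hu, hsq, hwu⟩
    rw [hdefect u hu hwu] at hsq
    rw [hsq, hwu, mul_assoc, hzr, mul_assoc]

end RegOp

theorem proposition6p3 {A : Type*} [NonUnitalCStarAlgebra A]
    (T : A →ₗ.[ℂ] A) (hT : RegOp.IsRegular T)
    (z : 𝓜(ℂ, A)) (hz : RegOp.IsZTransform T z)
    (S : A →ₗ.[ℂ] A) (hS : RegOp.IsRegular S)
    (zS : 𝓜(ℂ, A)) (hzS : RegOp.IsZTransform S zS) :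
    T ≤ S ↔
      ∃ u : 𝓜(ℂ, A), u * star u = 1 ∧
        CFC.sqrt (u * (1 - z * star z) * star u) = u * CFC.sqrt (1 - z * star z) ∧
        zS = u * z := by
  rw [hz.le_iff hT.dense_domain hS.dense_domain hzS]
  exact RegOp.mul_sqrt_eq_sqrt_mul_iff (hz.le_one_and_mem_graph_iff hT.dense_domain).1
    (hzS.le_one_and_mem_graph_iff hS.dense_domain).1
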